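/- **Theorem 8.1.** Let $(T,\mathcal F,\mu)$ be a $\sigma$-finite measure space with $\mu(T)>0$, let $Y$ be a reflexive real Banach space, let $p>0$, and let $\varphi,\psi:Y\to\mathbb R$ be two sequentially weakly lower semicontinuous functionals such that $$\inf_{y\in Y}\frac{\min\{\varphi(y),\psi(y)\}}{1+\|y\|^p}>-\infty .\tag{8.1}$$ For $\lambda\in[0,+\infty[$ let $M_\lambda$ be the set of all global minima (minimum points) of $\varphi+\lambda\psi$ on $Y$, and let $M_{+\infty}=\emptyset$. Let $a,b\in[0,+\infty]$ with $a<b$ and, with the conventions $\inf\emptyset=+\infty$ and $\sup\emptyset=-\infty$, put $$\alpha=\max\Big\{\inf_Y\psi,\ \sup_{M_b}\psi\Big\},\qquad \beta=\min\Big\{\sup_Y\psi,\ \inf_{M_a}\psi\Big\}.$$ Let $L^p(T,Y)$ be the space of all $\mu$-strongly measurable $u:T\to Y$ with $\int_T\|u(t)\|^p\,d\mu<+\infty$. Assume that, for each $\lambda\in\,]a,b[$, the functional $\varphi+\lambda\psi$ is coercive (that is, $\varphi(y)+\lambda\psi(y)\to+\infty$ as $\|y\|\to+\infty$) and has a unique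 global minimum in $Y$. Assume also that $\alpha<\beta$. Then, for each $\gamma\in L^\infty(T)\cap L^1(T)\setminus\{0\}$ with $\gamma\ge 0$ and each real $r\in\,]\alpha,\beta[$, the integrals $\int_T\gamma(t)\varphi(u(t))\,d\mu$ and $\int_T\gamma(t)\psi(u(t))\,d\mu$ exist in $]-\infty,+\infty]$ for every $u\in L^p(T,Y)$ and, if we put $$V_{\gamma,r}=\Big\{u\in L^p(T,Y):\int_T\gamma(t)\psi(u(t))\,d\mu\le r\int_T\gamma(t)\,d\mu\Big\},$$ we have $$\inf_{u\in V_{\gamma,r}}\int_T\gamma(t)\varphi(u(t))\,d\mu=\Big(\inf_{\psi^{-1}(r)}\varphi\Big)\int_T\gamma(t)\,d\mu .$$ -/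

import Mathlib

open Filter Topology MeasureTheory
open scoped ENNReal

/-- A real normed space is reflexive if the canonical embedding in its bidual is onto. -/
def IsReflexiveSpace (Y : Type*) [NormedAddCommGroup Y] [NormedSpace ℝ Y] : Prop :=
  Function.Surjective (NormedSpace.inclusionInDoubleDual ℝ Y)

/-- Sequential lower semicontinuity with respect to the weak topology of `Y`. -/
def SeqWeaklyLSC {Y : Type*} [NormedAddCommGroup Y] [NormedSpace ℝ Y] (f : Y → ℝ) : Prop :=
  ∀ (x : ℕ → Y) (y : Y),
    Tendsto (fun n => toWeakSpace ℝ Y (x n)) atTop (𝓝 (toWeakSpace ℝ Y y)) →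
      (f y : EReal) ≤ liminf (fun n => (f (x n) : EReal)) atTop

/-- `f y → +∞` as `‖y‖ → +∞`. -/
def IsCoerciveFunctional {Y : Type*} [NormedAddCommGroup Y] (f : Y → ℝ) : Prop :=
  Tendsto f (comap norm atTop) atTop

/-- For finite `l` the set of all global minima of `φ + l ψ`; the empty set for `l = +∞`. -/
def globalMinima {Y : Type*} (φ ψ : Y → ℝ) (l : ℝ≥0∞) : Set Y :=
  {y | l ≠ ∞ ∧ ∀ z, φ y + l.toReal * ψ y ≤ φ z + l.toReal * ψ z}

/-- `max {inf ψ, sup of ψ over the global minima of φ + b ψ}`, with `sup ∅ = -∞`. -/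
noncomputable def alphaBound {Y : Type*} (φ ψ : Y → ℝ) (b : ℝ≥0∞) : EReal :=
  max (⨅ y, (ψ y : EReal)) (⨆ y ∈ globalMinima φ ψ b, (ψ y : EReal))

/-- `min {sup ψ, inf of ψ over the global minima of φ + a ψ}`, with `inf ∅ = +∞`. -/
noncomputable def betaBound {Y : Type*} (φ ψ : Y → ℝ) (a : ℝ≥0∞) : EReal :=
  min (⨆ y, (ψ y : EReal)) (⨅ y ∈ globalMinima φ ψ a, (ψ y : EReal))

/-- The integral of `f` exists and belongs to `]-∞, +∞]`: `f` is `μ`-measurable and its negative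
part has finite integral. -/
def HasIntegralAboveBot {T : Type*} [MeasurableSpace T] (μ : Measure T) (f : T → ℝ) : Prop :=
  AEMeasurable f μ ∧ ∫⁻ t, ENNReal.ofReal (-f t) ∂μ < ∞

/-- The extended-real Lebesgue integral `∫ f⁺ dμ - ∫ f⁻ dμ` (meaningful under
`HasIntegralAboveBot μ f`). -/
noncomputable def extIntegral {T : Type*} [MeasurableSpace T] (μ : Measure T) (f : T → ℝ) :
    EReal :=
  ((∫⁻ t, ENNReal.ofReal (f t) ∂μ : ℝ≥0∞) : EReal) -
    ((∫⁻ t, ENNReal.ofReal (-f t) ∂μ : ℝ≥0∞) : EReal)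

/-- The set `V` of all `u ∈ L^p(T, Y)` with `∫ γ ψ(u) dμ ≤ r ∫ γ dμ`. -/
def constraintSet {T Y : Type*} [MeasurableSpace T] [NormedAddCommGroup Y] (μ : Measure T)
    (p : ℝ) (ψ : Y → ℝ) (γ : T → ℝ) (r : ℝ) : Set (T → Y) :=
  {u | MemLp u (ENNReal.ofReal p) μ ∧
    extIntegral μ (fun t => γ t * ψ (u t)) ≤ ((r * ∫ t, γ t ∂μ : ℝ) : EReal)}

/-!
The problem of minimizing `∫ γ φ(u)` subject to `∫ γ ψ(u) ≤ r ∫ γ` is solved by a pointwise Lagrange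
multiplier. For `r` strictly between `α` and `β` there are `l > 0` and a global minimum `y` of
`φ + l ψ` with `ψ y = r` (`exists_minimizer_constraint_eq`); then `φ y` is the infimum of `φ` on
`ψ⁻¹(r)`, and integrating `φ y + l r ≤ φ (u t) + l ψ (u t)` against `γ` shows that
`φ y * ∫ γ` is a lower bound (`le_extIntegral_of_minimizer`).

The multiplier is found by a continuity argument. The values of `ψ` at the minimizers `y_l` decrease
with `l`, and by weak sequential compactness of bounded sequences in the reflexive space
(`IsReflexiveSpace.exists_subseq_tendsto_weak`) limits of minimizers are minimizers for the limit
multiplier, along which `ψ` converges if that multiplier is positive (`exists_limit_minimizer`).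
In the limits `l → a` and `l → b` this excludes that `ψ (y_l)` stays on one side of `r`, and inside
`]a, b[`, where minimizers are unique, it yields an intermediate value property
(`exists_minimizer_eq_of_le_of_ge`).

The bound is approached although constants need not belong to `L^p`: any `z` with `ψ z < r`, cut off
to `0` outside large sets of finite measure, becomes admissible and shows that the infimum is at most
`φ z * ∫ γ` (`iInf_constraintSet_le`). The minimizers `z` at levels `s < r` satisfy
`φ z ≤ φ y + l₀ (r - s)` with a fixed `l₀`, and `s → r` gives the equality.
-/

/-! ### Weak sequential compactness in reflexive spaces -/

/-- The closed span of a sequence is separable, so countably many norming functionals, one for each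
point of a dense sequence, separate its points. -/
theorem exists_seq_dual_separating_closure {Y : Type*} [NormedAddCommGroup Y] [NormedSpace ℝ Y]
    (x : ℕ → Y) : ∃ f : ℕ → StrongDual ℝ Y,
      ∀ z ∈ (Submodule.span ℝ (Set.range x)).topologicalClosure, (∀ n, f n z = 0) → z = 0 := by
  set M := (Submodule.span ℝ (Set.range x)).topologicalClosure with hM
  have hsep : TopologicalSpace.IsSeparable (M : Set Y) := by
    rw [hM, Submodule.topologicalClosure_coe]
    exact ((Set.countable_range x).isSeparable.span (R := ℝ)).closure
  have : TopologicalSpace.SeparableSpace M := hsep.separableSpace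
  have : Nonempty M := ⟨0⟩
  choose f hf1 hf2 using fun n : ℕ =>
    exists_dual_vector'' ℝ ((TopologicalSpace.denseSeq M n : M) : Y)
  refine ⟨f, fun z hz hfz => ?_⟩
  by_contra hz0
  have hpos : 0 < ‖z‖ / 2 := by positivity
  obtain ⟨n, hn⟩ := (TopologicalSpace.denseRange_denseSeq M).exists_dist_lt ⟨z, hz⟩ hpos
  rw [Subtype.dist_eq, dist_eq_norm] at hn
  set d : Y := ((TopologicalSpace.denseSeq M n : M) : Y)
  have h1 : ‖d‖ ≤ ‖z - d‖ := by
    have : f n (d - z) = ‖d‖ := by simp [hfz n, hf2 n, d]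
    calc ‖d‖ = f n (d - z) := this.symm
      _ ≤ ‖f n (d - z)‖ := le_abs_self _
      _ ≤ ‖f n‖ * ‖d - z‖ := (f n).le_opNorm _
      _ ≤ 1 * ‖d - z‖ := by gcongr; exact hf1 n
      _ = ‖z - d‖ := by rw [one_mul, norm_sub_rev]
  have h2 : ‖z‖ ≤ ‖z - d‖ + ‖d‖ := by simpa using norm_add_le (z - d) d
  simp only at hn
  linarith

/-- Bounded sequences in a reflexive space have weakly convergent subsequences. The weak closure of
the sequence is weakly compact by Banach-Alaoglu in the bidual; it lies in the closed span of the
sequence, because closed subspaces are weakly closed, and there countably many functionals separate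
points, which makes this compact set metrizable. -/
theorem IsReflexiveSpace.exists_subseq_tendsto_weak {Y : Type*} [NormedAddCommGroup Y]
    [NormedSpace ℝ Y] (hY : IsReflexiveSpace Y) (x : ℕ → Y) (C : ℝ) (hx : ∀ n, ‖x n‖ ≤ C) :
    ∃ (y : Y) (k : ℕ → ℕ), StrictMono k ∧
      Tendsto (fun n => toWeakSpace ℝ Y (x (k n))) atTop (𝓝 (toWeakSpace ℝ Y y)) := by
  set S : Set (WeakSpace ℝ Y) := Set.range fun n => toWeakSpace ℝ Y (x n)
  have hb : Bornology.IsBounded (toWeakSpace ℝ Y ⁻¹' S) := by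
    refine isBounded_iff_forall_norm_le.2 ⟨C, ?_⟩
    rintro y ⟨n, hn⟩
    rw [← (toWeakSpace ℝ Y).injective hn]
    exact hx n
  have hK : IsCompact (closure S) := by
    refine NormedSpace.isCompact_closure_of_isBounded ℝ Y S hb fun g _ => ?_
    obtain ⟨y, hy⟩ := hY (WeakDual.toStrongDual g)
    exact ⟨toWeakSpace ℝ Y y, hy⟩
  set M := (Submodule.span ℝ (Set.range x)).topologicalClosure with hM
  have hKM : closure S ⊆ toWeakSpace ℝ Y '' (M : Set Y) := by
    have hMcl : closure (M : Set Y) = M :=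
      (Submodule.isClosed_topologicalClosure _).closure_eq
    have hcl : IsClosed (toWeakSpace ℝ Y '' (M : Set Y)) := by
      have := M.convex.toWeakSpace_closure ℝ
      rw [hMcl] at this
      rw [this]
      exact isClosed_closure
    refine closure_minimal ?_ hcl
    rintro _ ⟨n, rfl⟩
    exact ⟨x n, Submodule.le_topologicalClosure _ (Submodule.subset_span ⟨n, rfl⟩), rfl⟩
  obtain ⟨f, hf⟩ := exists_seq_dual_separating_closure x
  have : CompactSpace (closure S) := isCompact_iff_compactSpace.mp hK
  have : TopologicalSpace.MetrizableSpace (closure S) := by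
    refine Metric.PiNatEmbed.TopologicalSpace.MetrizableSpace.of_countable_separating
      (Y := fun _ => ℝ)
      (fun n k => f n ((toWeakSpace ℝ Y).symm (k : WeakSpace ℝ Y))) (fun n => ?_) ?_
    · exact (WeakBilin.eval_continuous (topDualPairing ℝ Y).flip (f n)).comp
        continuous_subtype_val
    · rintro ⟨u, hu⟩ ⟨v, hv⟩ huv
      by_contra! h
      obtain ⟨u, huM, rfl⟩ := hKM hu
      obtain ⟨v, hvM, rfl⟩ := hKM hv
      refine huv (Subtype.ext ?_)
      have := hf (u - v) (M.sub_mem huM hvM) fun n => by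
        simpa [sub_eq_zero] using h n
      exact congrArg (toWeakSpace ℝ Y) (sub_eq_zero.1 this)
  obtain ⟨⟨w, hw⟩, k, hk, hlim⟩ := CompactSpace.tendsto_subseq
    (fun n => (⟨toWeakSpace ℝ Y (x n), subset_closure ⟨n, rfl⟩⟩ : closure S))
  refine ⟨(toWeakSpace ℝ Y).symm w, k, hk, ?_⟩
  simpa [Function.comp_def] using (continuous_subtype_val.tendsto _).comp hlim

/-! ### Semicontinuous and coercive functionals -/

theorem SeqWeaklyLSC.le_of_tendsto {Y : Type*} [NormedAddCommGroup Y] [NormedSpace ℝ Y]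
    {f : Y → ℝ} (hf : SeqWeaklyLSC f) {x : ℕ → Y} {y : Y} {g : ℕ → ℝ} {L : ℝ}
    (hx : Tendsto (fun n => toWeakSpace ℝ Y (x n)) atTop (𝓝 (toWeakSpace ℝ Y y)))
    (hg : Tendsto g atTop (𝓝 L)) (hfg : ∀ n, f (x n) ≤ g n) : f y ≤ L := by
  have hgE : Tendsto (fun n => (g n : EReal)) atTop (𝓝 (L : EReal)) :=
    (continuous_coe_real_ereal.tendsto L).comp hg
  have h : liminf (fun n => (f (x n) : EReal)) atTop ≤ liminf (fun n => (g n : EReal)) atTop :=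
    liminf_le_liminf (Eventually.of_forall fun n => EReal.coe_le_coe_iff.2 (hfg n))
  rw [hgE.liminf_eq] at h
  exact EReal.coe_le_coe_iff.1 ((hf x y hx).trans h)

theorem SeqWeaklyLSC.lowerSemicontinuous {Y : Type*} [NormedAddCommGroup Y] [NormedSpace ℝ Y]
    {f : Y → ℝ} (hf : SeqWeaklyLSC f) : LowerSemicontinuous f := by
  rw [lowerSemicontinuous_iff_isClosed_preimage]
  intro c
  refine IsSeqClosed.isClosed fun x y hx hxy => ?_
  exact hf.le_of_tendsto (((toWeakSpaceCLM ℝ Y).continuous.tendsto y).comp hxy)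
    tendsto_const_nhds hx

theorem IsCoerciveFunctional.exists_norm_le {Y : Type*} [NormedAddCommGroup Y] {f : Y → ℝ}
    (hf : IsCoerciveFunctional f) (B : ℝ) : ∃ C, ∀ y, f y ≤ B → ‖y‖ ≤ C := by
  have h := hf.eventually_gt_atTop B
  rw [eventually_comap, eventually_atTop] at h
  obtain ⟨C, hC⟩ := h
  refine ⟨C, fun y hy => ?_⟩
  by_contra! hlt
  exact (hC ‖y‖ hlt.le y rfl).not_ge hy

/-! ### Minimizers of the Lagrangian as functions of the multiplier -/

/-- The value of `ψ` at minimizers of `φ + l ψ` does not increase with the multiplier `l`. -/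
theorem minimizer_constraint_anti {Y : Type*} {φ ψ : Y → ℝ} {l m : ℝ} (hlm : l < m) {y w : Y}
    (hy : ∀ z, φ y + l * ψ y ≤ φ z + l * ψ z) (hw : ∀ z, φ w + m * ψ w ≤ φ z + m * ψ z) :
    ψ w ≤ ψ y := by
  have h1 := hy w
  have h2 := hw y
  have : (m - l) * ψ w ≤ (m - l) * ψ y := by linarith
  exact le_of_mul_le_mul_left this (by linarith)

/-- Stability of minimizers under a convergent sequence of multipliers `l n → L`. Coercivity at a
single multiplier `c`, which need not be a limit point or even nonnegative, is enough, since `ψ` is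
bounded along the sequence. For `L = 0` the lower bound on `ψ` can be lost in the limit. -/
theorem exists_limit_minimizer {Y : Type*} [NormedAddCommGroup Y] [NormedSpace ℝ Y]
    (hY : IsReflexiveSpace Y) {φ ψ : Y → ℝ} (hφ : SeqWeaklyLSC φ) (hψ : SeqWeaklyLSC ψ)
    {c : ℝ} (hc : IsCoerciveFunctional fun y => φ y + c * ψ y)
    {l : ℕ → ℝ} {L : ℝ} (hL : 0 ≤ L) (hl : Tendsto l atTop (𝓝 L)) {y : ℕ → Y}
    (hy : ∀ n z, φ (y n) + l n * ψ (y n) ≤ φ z + l n * ψ z) {A B : ℝ}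
    (hAB : ∀ n, ψ (y n) ∈ Set.Icc A B) :
    ∃ w, (∀ z, φ w + L * ψ w ≤ φ z + L * ψ z) ∧ ψ w ≤ B ∧ (0 < L → A ≤ ψ w) := by
  obtain ⟨s, hs, k, hk, hks⟩ := isCompact_Icc.tendsto_subseq hAB
  obtain ⟨C, hC⟩ : ∃ C, ∀ n, ‖y n‖ ≤ C := by
    obtain ⟨D, hD⟩ := hl.abs.bddAbove_range
    have hlD : ∀ n, |l n| ≤ D := fun n => hD ⟨n, rfl⟩
    have hψb : ∀ n, |ψ (y n)| ≤ max |A| |B| := fun n => abs_le_max_abs_abs (hAB n).1 (hAB n).2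
    obtain ⟨C, hC⟩ := hc.exists_norm_le (φ 0 + D * |ψ 0| + (|c| + D) * max |A| |B|)
    refine ⟨C, fun n => hC _ ?_⟩
    have h1 := hy n 0
    have h2 : l n * ψ 0 ≤ D * |ψ 0| :=
      (le_abs_self _).trans (by rw [abs_mul]; gcongr; exact hlD n)
    have h3 : (c - l n) * ψ (y n) ≤ (|c| + D) * max |A| |B| := by
      refine (le_abs_self _).trans ?_
      rw [abs_mul]
      have hcl : |c - l n| ≤ |c| + D := (abs_sub _ _).trans (by gcongr; exact hlD n)
      exact mul_le_mul hcl (hψb n) (abs_nonneg _) ((abs_nonneg _).trans hcl)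
    linarith
  obtain ⟨w, j, hj, hw⟩ := hY.exists_subseq_tendsto_weak (fun n => y (k n)) C fun n => hC _
  have hlj : Tendsto (fun n => l (k (j n))) atTop (𝓝 L) :=
    hl.comp (hk.tendsto_atTop.comp hj.tendsto_atTop)
  have hsj : Tendsto (fun n => ψ (y (k (j n)))) atTop (𝓝 s) := hks.comp hj.tendsto_atTop
  have hψw : ψ w ≤ s := hψ.le_of_tendsto hw hsj fun n => le_rfl
  have hφw : ∀ z, φ w ≤ φ z + L * ψ z - L * s := fun z =>
    hφ.le_of_tendsto hw (((hlj.mul_const (ψ z)).const_add (φ z)).sub (hlj.mul hsj))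
      fun n => by linarith [hy (k (j n)) z]
  -- `hφw` at `z = w` gives `L * s ≤ L * ψ w`, so `ψ w` is the limit `s` when `L > 0`
  refine ⟨w, fun z => ?_, hψw.trans hs.2, fun hL0 => hs.1.trans ?_⟩
  · linarith [hφw z, mul_le_mul_of_nonneg_left hψw hL]
  · exact le_of_mul_le_mul_left (by linarith [hφw w]) hL0

/-- If the constraint `ψ ≤ r` holds at minimizers for all multipliers slightly larger than `a`, it
holds at some minimizer for `a` itself, where no coercivity is assumed. -/
theorem exists_minimizer_left_le {Y : Type*} [NormedAddCommGroup Y] [NormedSpace ℝ Y]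
    (hY : IsReflexiveSpace Y) {φ ψ : Y → ℝ} (hφ : SeqWeaklyLSC φ) (hψ : SeqWeaklyLSC ψ)
    {a c r : ℝ} (ha : 0 ≤ a) (hac : a < c) (hc : IsCoerciveFunctional fun y => φ y + c * ψ y)
    (h : ∀ l ∈ Set.Ioc a c, ∃ y, (∀ z, φ y + l * ψ y ≤ φ z + l * ψ z) ∧ ψ y ≤ r) :
    ∃ y, (∀ z, φ y + a * ψ y ≤ φ z + a * ψ z) ∧ ψ y ≤ r := by
  obtain ⟨u, -, hu, hlim⟩ := exists_seq_strictAnti_tendsto' hac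
  choose y hy hyr using fun n => h (u n) ⟨(hu n).1, (hu n).2.le⟩
  obtain ⟨w, hw, -⟩ := h c ⟨hac, le_rfl⟩
  obtain ⟨v, hv, hvr, -⟩ := exists_limit_minimizer hY hφ hψ hc ha hlim hy
    (fun n => ⟨minimizer_constraint_anti (hu n).2 (hy n) hw, hyr n⟩)
  exact ⟨v, hv, hvr⟩

/-- If `r ≤ ψ` holds at minimizers for all multipliers slightly smaller than `b`, it holds at some
minimizer for `b` itself, where no coercivity is assumed. -/
theorem exists_minimizer_right_ge {Y : Type*} [NormedAddCommGroup Y] [NormedSpace ℝ Y]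
    (hY : IsReflexiveSpace Y) {φ ψ : Y → ℝ} (hφ : SeqWeaklyLSC φ) (hψ : SeqWeaklyLSC ψ)
    {b c r : ℝ} (hc0 : 0 ≤ c) (hcb : c < b) (hc : IsCoerciveFunctional fun y => φ y + c * ψ y)
    (h : ∀ l ∈ Set.Ico c b, ∃ y, (∀ z, φ y + l * ψ y ≤ φ z + l * ψ z) ∧ r ≤ ψ y) :
    ∃ y, (∀ z, φ y + b * ψ y ≤ φ z + b * ψ z) ∧ r ≤ ψ y := by
  obtain ⟨u, -, hu, hlim⟩ := exists_seq_strictMono_tendsto' hcb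
  choose y hy hyr using fun n => h (u n) ⟨(hu n).1.le, (hu n).2⟩
  obtain ⟨w, hw, -⟩ := h c ⟨le_rfl, hcb⟩
  obtain ⟨v, hv, -, hvr⟩ := exists_limit_minimizer hY hφ hψ hc (hc0.trans hcb.le) hlim hy
    (fun n => ⟨hyr n, minimizer_constraint_anti (hu n).1 hw (hy n)⟩)
  exact ⟨v, hv, hvr (hc0.trans_lt hcb)⟩

/-- The analogue of the limit `l → b` for `b = +∞`: a point with `ψ z < r` would make
`φ + l ψ` at `z` smaller than its minimum once `l` is large. -/
theorem le_constraint_of_forall_minimizer_ge {Y : Type*} {φ ψ : Y → ℝ} {c r : ℝ}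
    (h : ∀ l, c ≤ l → ∃ y, (∀ z, φ y + l * ψ y ≤ φ z + l * ψ z) ∧ r ≤ ψ y) (z : Y) :
    r ≤ ψ z := by
  by_contra! hz
  obtain ⟨w, hw, -⟩ := h c le_rfl
  have hd : 0 < r - ψ z := by linarith
  set K := φ z + c * ψ z - (φ w + c * ψ w)
  have hK : 0 ≤ K := by linarith [hw z]
  -- a multiplier with `(l - c) * (r - ψ z) > K` contradicts minimality at `l`
  obtain ⟨y, hy, hyr⟩ := h (c + (K + 1) / (r - ψ z)) (le_add_of_nonneg_right (by positivity))
  set e := (K + 1) / (r - ψ z)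
  have he : e * (r - ψ z) = K + 1 := div_mul_cancel₀ _ hd.ne'
  have he0 : 0 ≤ e := by positivity
  have h3 : e * r ≤ e * ψ y := by gcongr
  linarith [hy z, hw y]

/-- An intermediate value property in the multiplier: the multipliers whose minimizer satisfies
`r ≤ ψ`, and those whose minimizer satisfies `ψ ≤ r`, form two closed sets covering the connected
interval `[c, d]`, so they meet; uniqueness of the minimizer makes both inequalities hold at the
same point. -/
theorem exists_minimizer_eq_of_le_of_ge {Y : Type*} [NormedAddCommGroup Y] [NormedSpace ℝ Y]
    (hY : IsReflexiveSpace Y) {φ ψ : Y → ℝ} (hφ : SeqWeaklyLSC φ) (hψ : SeqWeaklyLSC ψ)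
    {c d r : ℝ} (hc0 : 0 < c) (hcd : c ≤ d)
    (hc : IsCoerciveFunctional fun y => φ y + c * ψ y)
    (h : ∀ l ∈ Set.Icc c d, ∃! y, ∀ z, φ y + l * ψ y ≤ φ z + l * ψ z)
    {v w : Y} (hv : ∀ z, φ v + c * ψ v ≤ φ z + c * ψ z) (hvr : r ≤ ψ v)
    (hw : ∀ z, φ w + d * ψ w ≤ φ z + d * ψ z) (hwr : ψ w ≤ r) :
    ∃ l ∈ Set.Icc c d, ∃ y, (∀ z, φ y + l * ψ y ≤ φ z + l * ψ z) ∧ ψ y = r := by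
  have hb : ∀ l ∈ Set.Icc c d, ∀ y, (∀ z, φ y + l * ψ y ≤ φ z + l * ψ z) →
      ψ w ≤ ψ y ∧ ψ y ≤ ψ v := by
    intro l hl y hy
    constructor
    · rcases hl.2.eq_or_lt with rfl | hlt
      · rw [(h l hl).unique hw hy]
      · exact minimizer_constraint_anti hlt hy hw
    · rcases hl.1.eq_or_lt with rfl | hlt
      · rw [(h c hl).unique hv hy]
      · exact minimizer_constraint_anti hlt hv hy
  set P : Set ℝ := {l | l ∈ Set.Icc c d ∧
    ∃ y, (∀ z, φ y + l * ψ y ≤ φ z + l * ψ z) ∧ r ≤ ψ y}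
  set Q : Set ℝ := {l | l ∈ Set.Icc c d ∧
    ∃ y, (∀ z, φ y + l * ψ y ≤ φ z + l * ψ z) ∧ ψ y ≤ r}
  have hP : IsClosed P := by
    refine IsSeqClosed.isClosed fun u L hu hL => ?_
    have hLm : L ∈ Set.Icc c d := isClosed_Icc.isSeqClosed (fun n => (hu n).1) hL
    choose y hy hyr using fun n => (hu n).2
    obtain ⟨q, hq, -, hqr⟩ := exists_limit_minimizer hY hφ hψ hc (hc0.le.trans hLm.1) hL hy
      fun n => ⟨hyr n, (hb _ (hu n).1 _ (hy n)).2⟩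
    exact ⟨hLm, q, hq, hqr (hc0.trans_le hLm.1)⟩
  have hQ : IsClosed Q := by
    refine IsSeqClosed.isClosed fun u L hu hL => ?_
    have hLm : L ∈ Set.Icc c d := isClosed_Icc.isSeqClosed (fun n => (hu n).1) hL
    choose y hy hyr using fun n => (hu n).2
    obtain ⟨q, hq, hqr, -⟩ := exists_limit_minimizer hY hφ hψ hc (hc0.le.trans hLm.1) hL hy
      fun n => ⟨(hb _ (hu n).1 _ (hy n)).1, hyr n⟩
    exact ⟨hLm, q, hq, hqr⟩
  obtain ⟨l, hl, ⟨-, y, hy, hyr⟩, -, y', hy', hyr'⟩ :=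
    isPreconnected_closed_iff.1 isPreconnected_Icc P Q hP hQ
      (fun l hl => by
        obtain ⟨y, hy, -⟩ := h l hl
        rcases le_total r (ψ y) with h1 | h1
        · exact Or.inl ⟨hl, y, hy, h1⟩
        · exact Or.inr ⟨hl, y, hy, h1⟩)
      ⟨c, ⟨le_rfl, hcd⟩, ⟨le_rfl, hcd⟩, v, hv, hvr⟩
      ⟨d, ⟨hcd, le_rfl⟩, ⟨hcd, le_rfl⟩, w, hw, hwr⟩
  refine ⟨l, hl, y, hy, le_antisymm ?_ hyr⟩
  rwa [(h l hl).unique hy hy']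

theorem mem_globalMinima_ofReal {Y : Type*} {φ ψ : Y → ℝ} {l : ℝ} (hl : 0 ≤ l) {y : Y} :
    y ∈ globalMinima φ ψ (ENNReal.ofReal l) ↔ ∀ z, φ y + l * ψ y ≤ φ z + l * ψ z := by
  simp [globalMinima, ENNReal.toReal_ofReal hl]

/-- Every level `r` strictly between the two bounds is attained by `ψ` at a global minimum of
`φ + l ψ` for some real `l > 0`, so that this minimum solves the problem of minimizing `φ` on
`{ψ = r}` with Lagrange multiplier `l`. -/
theorem exists_minimizer_constraint_eq {Y : Type*} [NormedAddCommGroup Y] [NormedSpace ℝ Y]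
    (hY : IsReflexiveSpace Y) {φ ψ : Y → ℝ} (hφ : SeqWeaklyLSC φ) (hψ : SeqWeaklyLSC ψ)
    {a b : ℝ≥0∞} (hab : a < b)
    (hcoer : ∀ l ∈ Set.Ioo a b, IsCoerciveFunctional (fun y => φ y + l.toReal * ψ y))
    (hmin : ∀ l ∈ Set.Ioo a b, ∃! y, y ∈ globalMinima φ ψ l)
    {r : ℝ} (hαr : alphaBound φ ψ b < (r : EReal)) (hrβ : (r : EReal) < betaBound φ ψ a) :
    ∃ l : ℝ, 0 < l ∧ ∃ y, (∀ z, φ y + l * ψ y ≤ φ z + l * ψ z) ∧ ψ y = r := by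
  lift a to NNReal using hab.ne_top
  have hI : ∀ l : ℝ, (a : ℝ) < l → ENNReal.ofReal l < b → ENNReal.ofReal l ∈ Set.Ioo (a : ℝ≥0∞) b :=
    fun l h1 h2 => ⟨by
      rw [← ENNReal.ofReal_coe_nnreal]
      exact (ENNReal.ofReal_lt_ofReal_iff (a.2.trans_lt h1)).2 h1, h2⟩
  have hco : ∀ l : ℝ, (a : ℝ) < l → ENNReal.ofReal l < b →
      IsCoerciveFunctional (fun y => φ y + l * ψ y) := fun l h1 h2 => by
    have := hcoer _ (hI l h1 h2)
    rwa [ENNReal.toReal_ofReal (a.2.trans h1.le)] at this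
  have hmi : ∀ l : ℝ, (a : ℝ) < l → ENNReal.ofReal l < b →
      ∃! y, ∀ z, φ y + l * ψ y ≤ φ z + l * ψ z := fun l h1 h2 => by
    simpa only [mem_globalMinima_ofReal (a.2.trans h1.le)] using hmin _ (hI l h1 h2)
  obtain ⟨x, hax, hxb⟩ := exists_between hab
  lift x to NNReal using hxb.ne_top
  have hax' : (a : ℝ) < x := by exact_mod_cast hax
  have hxb' : ENNReal.ofReal x < b := by simpa using hxb
  have hle : ∀ {l m : ℝ}, l ≤ m → ENNReal.ofReal m < b → ENNReal.ofReal l < b :=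
    fun h1 h2 => (ENNReal.ofReal_le_ofReal h1).trans_lt h2
  -- were `ψ < r` at all minimizers near `a`, the limit `l → a` would give a point of `M_a`
  -- with `ψ ≤ r`, against `r < β`
  obtain ⟨c, hac, hcx, v, hv, hvr⟩ : ∃ c : ℝ, (a : ℝ) < c ∧ c ≤ x ∧
      ∃ v, (∀ z, φ v + c * ψ v ≤ φ z + c * ψ z) ∧ r ≤ ψ v := by
    by_contra! hcon
    obtain ⟨y, hy, hyr⟩ := exists_minimizer_left_le (r := r) hY hφ hψ a.2 hax' (hco x hax' hxb')
      fun l hl => by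
        obtain ⟨y, hy, -⟩ := hmi l hl.1 (hle hl.2 hxb')
        exact ⟨y, hy, (hcon l hl.1 hl.2 y hy).le⟩
    have hmem : y ∈ globalMinima φ ψ a := ⟨ENNReal.coe_ne_top, by simpa using hy⟩
    have h1 : betaBound φ ψ a ≤ (ψ y : EReal) := (min_le_right _ _).trans (iInf₂_le y hmem)
    exact (hrβ.trans_le h1).not_ge (EReal.coe_le_coe_iff.2 hyr)
  have hcb : ENNReal.ofReal c < b := hle hcx hxb'
  have hc0 : 0 < c := a.2.trans_lt hac
  -- symmetrically, `ψ > r` at all minimizers from `c` on contradicts `α < r`: through `M_b` if `b` is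
  -- finite, and through `inf ψ` if `b = ∞`
  obtain ⟨d, hcd, hdb, w, hw, hwr⟩ : ∃ d : ℝ, c ≤ d ∧ ENNReal.ofReal d < b ∧
      ∃ w, (∀ z, φ w + d * ψ w ≤ φ z + d * ψ z) ∧ ψ w ≤ r := by
    by_contra! hcon
    have hge : ∀ l, c ≤ l → ENNReal.ofReal l < b →
        ∃ y, (∀ z, φ y + l * ψ y ≤ φ z + l * ψ z) ∧ r ≤ ψ y := fun l h1 h2 => by
      obtain ⟨y, hy, -⟩ := hmi l (hac.trans_le h1) h2
      exact ⟨y, hy, (hcon l h1 h2 y hy).le⟩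
    rcases eq_or_ne b ∞ with rfl | hbtop
    · have h1 : (r : EReal) ≤ ⨅ y, (ψ y : EReal) := le_iInf fun z =>
        EReal.coe_le_coe_iff.2 (le_constraint_of_forall_minimizer_ge
          (fun l hl => hge l hl ENNReal.ofReal_lt_top) z)
      exact ((le_max_left _ _).trans_lt hαr).not_ge h1
    · lift b to NNReal using hbtop
      have hlt : ∀ {l : ℝ}, l < b → ENNReal.ofReal l < b := fun {l} hl => by
        rw [← ENNReal.ofReal_coe_nnreal]
        rcases le_or_gt l 0 with h0 | h0
        · exact (ENNReal.ofReal_le_ofReal (h0.trans hc0.le)).trans_lt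
            (by rwa [ENNReal.ofReal_coe_nnreal])
        · exact (ENNReal.ofReal_lt_ofReal_iff (h0.trans hl)).2 hl
      have hcb' : c < b := by
        rw [← ENNReal.ofReal_coe_nnreal] at hcb
        exact (ENNReal.ofReal_lt_ofReal_iff_of_nonneg hc0.le).1 hcb
      obtain ⟨y, hy, hyr⟩ := exists_minimizer_right_ge (r := r) hY hφ hψ hc0.le hcb'
        (hco c hac hcb) fun l hl => hge l hl.1 (hlt hl.2)
      have hmem : y ∈ globalMinima φ ψ b := ⟨ENNReal.coe_ne_top, by simpa using hy⟩
      have h1 : (ψ y : EReal) ≤ alphaBound φ ψ b :=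
        (le_iSup₂ (f := fun y (_ : y ∈ globalMinima φ ψ b) => (ψ y : EReal)) y hmem).trans
          (le_max_right _ _)
      exact (h1.trans_lt hαr).not_ge (EReal.coe_le_coe_iff.2 hyr)
  obtain ⟨l, hl, y, hy, hyr⟩ := exists_minimizer_eq_of_le_of_ge hY hφ hψ hc0 hcd
    (hco c hac hcb) (fun l hl => hmi l (hac.trans_le hl.1) (hle hl.2 hdb)) hv hvr hw hwr
  exact ⟨l, hc0.trans_le hl.1, y, hy, hyr⟩

/-! ### Extended-real integrals and the integrability of superposition operators -/

theorem extIntegral_eq_integral {T : Type*} [MeasurableSpace T] {μ : Measure T} {f : T → ℝ}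
    (hf : Integrable f μ) : extIntegral μ f = ((∫ t, f t ∂μ : ℝ) : EReal) := by
  have h1 : ∫⁻ t, ENNReal.ofReal (f t) ∂μ ≠ ∞ := hf.lintegral_lt_top.ne
  have h2 : ∫⁻ t, ENNReal.ofReal (-f t) ∂μ ≠ ∞ := hf.neg.lintegral_lt_top.ne
  rw [integral_eq_lintegral_pos_part_sub_lintegral_neg_part hf, EReal.coe_sub,
    EReal.coe_ennreal_toReal h1, EReal.coe_ennreal_toReal h2, extIntegral]

theorem HasIntegralAboveBot.integrable {T : Type*} [MeasurableSpace T] {μ : Measure T}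
    {f : T → ℝ} (hf : HasIntegralAboveBot μ f) (h : extIntegral μ f < ⊤) : Integrable f μ := by
  have hpos : ∫⁻ t, ENNReal.ofReal (f t) ∂μ < ∞ := by
    rw [lt_top_iff_ne_top]
    intro htop
    rw [extIntegral, htop] at h
    lift ∫⁻ t, ENNReal.ofReal (-f t) ∂μ to NNReal using hf.2.ne with c
    exact h.ne (EReal.top_sub_coe (c : ℝ))
  refine ⟨hf.1.aestronglyMeasurable, ?_⟩
  rw [hasFiniteIntegral_iff_norm]
  calc ∫⁻ t, ENNReal.ofReal ‖f t‖ ∂μ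
      ≤ ∫⁻ t, (ENNReal.ofReal (f t) + ENNReal.ofReal (-f t)) ∂μ := by
        refine lintegral_mono fun t => ?_
        rcases le_total 0 (f t) with h0 | h0
        · rw [Real.norm_of_nonneg h0]; exact le_self_add
        · rw [Real.norm_of_nonpos h0]; exact le_add_self
    _ = ∫⁻ t, ENNReal.ofReal (f t) ∂μ + ∫⁻ t, ENNReal.ofReal (-f t) ∂μ :=
        lintegral_add_left' hf.1.ennreal_ofReal _
    _ < ∞ := ENNReal.add_lt_top.2 ⟨hpos, hf.2⟩

theorem hasIntegralAboveBot_mul_comp {T Y : Type*} [MeasurableSpace T] {μ : Measure T}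
    [NormedAddCommGroup Y] {f : Y → ℝ} (hf : LowerSemicontinuous f) {p K : ℝ} (hp : 0 < p)
    (hfK : ∀ y, -(K * (1 + ‖y‖ ^ p)) ≤ f y) {γ : T → ℝ} (hγtop : MemLp γ ∞ μ)
    (hγone : Integrable γ μ) (hγnonneg : 0 ≤ᵐ[μ] γ) {u : T → Y}
    (hu : MemLp u (ENNReal.ofReal p) μ) : HasIntegralAboveBot μ fun t => γ t * f (u t) := by
  let _ : MeasurableSpace Y := borel Y
  have : BorelSpace Y := ⟨rfl⟩
  refine ⟨hγone.aemeasurable.mul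
    (hf.measurable.comp_aemeasurable hu.aestronglyMeasurable.aemeasurable), ?_⟩
  have hup : Integrable (fun t => ‖u t‖ ^ p) μ := by
    simpa [ENNReal.toReal_ofReal hp.le] using
      hu.integrable_norm_rpow (by simpa using hp) ENNReal.ofReal_ne_top
  have hint : Integrable (fun t => K * (γ t + γ t * ‖u t‖ ^ p)) μ :=
    (hγone.add (hup.mul_of_top_right hγtop)).const_mul K
  refine lt_of_le_of_lt (lintegral_mono_ae ?_) hint.lintegral_lt_top
  filter_upwards [hγnonneg] with t ht
  refine ENNReal.ofReal_le_ofReal ?_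
  have := mul_le_mul_of_nonneg_left (hfK (u t)) ht
  linarith

/-- The growth condition in product form. The constant `K` may have either sign. -/
theorem neg_mul_le_of_bddBelow_div {Y : Type*} {f w : Y → ℝ} (hw : ∀ y, 0 < w y)
    (h : BddBelow (Set.range fun y => f y / w y)) : ∃ K, ∀ y, -(K * w y) ≤ f y := by
  obtain ⟨m, hm⟩ := h
  refine ⟨-m, fun y => ?_⟩
  have := (le_div_iff₀ (hw y)).1 (hm ⟨y, rfl⟩)
  linarith

theorem abs_comp_indicator_const_le {T Y : Type*} [Zero Y] (f : Y → ℝ) (S : Set T) (y : Y)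
    (t : T) : |f (S.indicator (fun _ => y) t)| ≤ |f y| + |f 0| := by
  by_cases ht : t ∈ S
  · simp [ht]
  · simp [ht]

/-! ### Integrals along truncated constant functions -/

theorem integrable_mul_comp_indicator {T Y : Type*} [MeasurableSpace T] {μ : Measure T}
    [Zero Y] (f : Y → ℝ) {γ : T → ℝ} (hγ : Integrable γ μ) {S : Set T}
    (hS : MeasurableSet S) (y : Y) :
    Integrable (fun t => γ t * f (S.indicator (fun _ => y) t)) μ := by
  have h : (fun t => γ t * f (S.indicator (fun _ => y) t)) =
      S.indicator (fun t => γ t * f y) + Sᶜ.indicator (fun t => γ t * f 0) := by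
    ext t
    by_cases ht : t ∈ S <;> simp [ht]
  rw [h]
  exact ((hγ.mul_const _).indicator hS).add ((hγ.mul_const _).indicator hS.compl)

theorem tendsto_integral_mul_comp_indicator_spanningSets {T Y : Type*} [MeasurableSpace T]
    (μ : Measure T) [SigmaFinite μ] [Zero Y] (f : Y → ℝ) {γ : T → ℝ}
    (hγ : Integrable γ μ) (y : Y) :
    Tendsto (fun n => ∫ t, γ t * f ((spanningSets μ n).indicator (fun _ => y) t) ∂μ) atTop
      (𝓝 (f y * ∫ t, γ t ∂μ)) := by
  have h : f y * ∫ t, γ t ∂μ = ∫ t, γ t * f y ∂μ := by rw [integral_mul_const, mul_comm]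
  rw [h]
  refine tendsto_integral_of_dominated_convergence (fun t => |γ t| * (|f y| + |f 0|))
    (fun n => (integrable_mul_comp_indicator f hγ
      (measurableSet_spanningSets μ n) y).aestronglyMeasurable)
    (hγ.abs.mul_const _) (fun n => Eventually.of_forall fun t => ?_)
    (Eventually.of_forall fun t => ?_)
  · rw [Real.norm_eq_abs, abs_mul]
    gcongr
    exact abs_comp_indicator_const_le f _ y t
  · refine tendsto_const_nhds.congr' ?_
    filter_upwards [eventually_mem_spanningSets μ t] with n hn
    simp [hn]

/-! ### The value of the constrained problem -/

/-- Weak duality: the pointwise inequality `φ y + l r ≤ φ (u t) + l ψ (u t)`, multiplied by `γ` and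
integrated, bounds `∫ γ φ(u)` from below on the constraint set. -/
theorem le_extIntegral_of_minimizer {T Y : Type*} [MeasurableSpace T] {μ : Measure T}
    {φ ψ : Y → ℝ} {l r : ℝ} (hl : 0 ≤ l) {y : Y}
    (hy : ∀ z, φ y + l * ψ y ≤ φ z + l * ψ z) (hyr : ψ y = r) {γ : T → ℝ}
    (hγ : Integrable γ μ) (hγnonneg : 0 ≤ᵐ[μ] γ) {u : T → Y}
    (hφu : HasIntegralAboveBot μ fun t => γ t * φ (u t))
    (hψu : HasIntegralAboveBot μ fun t => γ t * ψ (u t))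
    (hu : extIntegral μ (fun t => γ t * ψ (u t)) ≤ ((r * ∫ t, γ t ∂μ : ℝ) : EReal)) :
    ((φ y * ∫ t, γ t ∂μ : ℝ) : EReal) ≤ extIntegral μ fun t => γ t * φ (u t) := by
  rcases eq_top_or_lt_top (extIntegral μ fun t => γ t * φ (u t)) with htop | htop
  · rw [htop]; exact le_top
  have hφi := hφu.integrable htop
  have hψi := hψu.integrable (hu.trans_lt (EReal.coe_lt_top _))
  rw [extIntegral_eq_integral hψi, EReal.coe_le_coe_iff] at hu
  rw [extIntegral_eq_integral hφi, EReal.coe_le_coe_iff]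
  have h1 : ∫ t, γ t * (φ y + l * r) ∂μ ≤ ∫ t, (γ t * φ (u t) + l * (γ t * ψ (u t))) ∂μ := by
    refine integral_mono_ae (hγ.mul_const _) (hφi.add (hψi.const_mul l)) ?_
    filter_upwards [hγnonneg] with t ht
    have := mul_le_mul_of_nonneg_left (hy (u t)) ht
    rw [hyr] at this
    linarith
  rw [integral_mul_const, integral_add hφi (hψi.const_mul l), integral_const_mul] at h1
  have h2 := mul_le_mul_of_nonneg_left hu hl
  linarith

/-- A point `y` with `ψ y < r` bounds the infimum on the constraint set from above. The constant
function `y` need not be in `L^p` when `μ` is infinite; the functions equal to `y` on an exhausting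
sequence of sets of finite measure and to `0` elsewhere are, and the strict inequality absorbs the
contribution of `ψ 0`, which may exceed `r`. -/
theorem iInf_constraintSet_le {T Y : Type*} [MeasurableSpace T] (μ : Measure T) [SigmaFinite μ]
    [NormedAddCommGroup Y] {φ ψ : Y → ℝ} {p r : ℝ} {γ : T → ℝ} (hγ : Integrable γ μ)
    (hγpos : 0 < ∫ t, γ t ∂μ) {y : Y} (hy : ψ y < r) :
    ⨅ u ∈ constraintSet μ p ψ γ r, extIntegral μ (fun t => γ t * φ (u t)) ≤
      ((φ y * ∫ t, γ t ∂μ : ℝ) : EReal) := by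
  have hφlim := tendsto_integral_mul_comp_indicator_spanningSets μ φ hγ y
  have hψlim := tendsto_integral_mul_comp_indicator_spanningSets μ ψ hγ y
  refine ge_of_tendsto ((continuous_coe_real_ereal.tendsto _).comp hφlim) ?_
  filter_upwards [hψlim.eventually_lt_const (mul_lt_mul_of_pos_right hy hγpos)] with n hn
  have hi := fun f : Y → ℝ =>
    integrable_mul_comp_indicator f hγ (measurableSet_spanningSets μ n) y
  refine (iInf₂_le ((spanningSets μ n).indicator fun _ => y) ⟨?_, ?_⟩).trans_eq
    (extIntegral_eq_integral (hi φ))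
  · exact memLp_indicator_const _ (measurableSet_spanningSets μ n) y
      (Or.inr (measure_spanningSets_lt_top μ n).ne)
  · rw [extIntegral_eq_integral (hi ψ)]
    exact EReal.coe_le_coe_iff.2 hn.le

theorem theorem8p1 {T : Type*} [MeasurableSpace T] (μ : Measure T) [SigmaFinite μ]
    {Y : Type*} [NormedAddCommGroup Y] [NormedSpace ℝ Y] [CompleteSpace Y]
    (hY : IsReflexiveSpace Y) (φ ψ : Y → ℝ)
    (hφ : SeqWeaklyLSC φ) (hψ : SeqWeaklyLSC ψ)
    (p : ℝ) (hp : 0 < p)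
    (hgrowth : BddBelow (Set.range fun y : Y => min (φ y) (ψ y) / (1 + ‖y‖ ^ p)))
    (a b : ℝ≥0∞) (hab : a < b)
    (hcoer : ∀ l ∈ Set.Ioo a b, IsCoerciveFunctional (fun y => φ y + l.toReal * ψ y))
    (hmin : ∀ l ∈ Set.Ioo a b, ∃! y, y ∈ globalMinima φ ψ l)
    (hαβ : alphaBound φ ψ b < betaBound φ ψ a)
    (γ : T → ℝ) (hγtop : MemLp γ ∞ μ) (hγone : MemLp γ 1 μ)
    (hγnonneg : 0 ≤ᵐ[μ] γ) (hγne : ¬ γ =ᵐ[μ] 0)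
    (r : ℝ) (hαr : alphaBound φ ψ b < (r : EReal)) (hrβ : (r : EReal) < betaBound φ ψ a) :
    (∀ u : T → Y, MemLp u (ENNReal.ofReal p) μ →
      HasIntegralAboveBot μ (fun t => γ t * φ (u t)) ∧
        HasIntegralAboveBot μ (fun t => γ t * ψ (u t))) ∧
    ⨅ u ∈ constraintSet μ p ψ γ r, extIntegral μ (fun t => γ t * φ (u t)) =
      (⨅ y ∈ ψ ⁻¹' {r}, (φ y : EReal)) * ((∫ t, γ t ∂μ : ℝ) : EReal) := by

  have hγ : Integrable γ μ := memLp_one_iff_integrable.1 hγone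
  have hγpos : 0 < ∫ t, γ t ∂μ :=
    (integral_nonneg_of_ae hγnonneg).lt_of_ne' fun h =>
      hγne ((integral_eq_zero_iff_of_nonneg_ae hγnonneg hγ).1 h)
  obtain ⟨K, hK⟩ := neg_mul_le_of_bddBelow_div (fun y : Y => by positivity) hgrowth
  have hint : ∀ u : T → Y, MemLp u (ENNReal.ofReal p) μ →
      HasIntegralAboveBot μ (fun t => γ t * φ (u t)) ∧
        HasIntegralAboveBot μ (fun t => γ t * ψ (u t)) := fun u hu =>
    ⟨hasIntegralAboveBot_mul_comp hφ.lowerSemicontinuous hp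
        (fun y => (hK y).trans (min_le_left _ _)) hγtop hγ hγnonneg hu,
      hasIntegralAboveBot_mul_comp hψ.lowerSemicontinuous hp
        (fun y => (hK y).trans (min_le_right _ _)) hγtop hγ hγnonneg hu⟩
  refine ⟨hint, ?_⟩
  have hlevel := fun {s : ℝ} => exists_minimizer_constraint_eq (r := s) hY hφ hψ hab hcoer hmin
  obtain ⟨l, hl, y, hy, hyr⟩ := hlevel hαr hrβ
  have hinf : ⨅ z ∈ ψ ⁻¹' {r}, (φ z : EReal) = φ y := by
    refine le_antisymm (iInf₂_le y hyr) (le_iInf₂ fun z hz => EReal.coe_le_coe_iff.2 ?_)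
    have := hy z
    rw [hyr, show ψ z = r from hz] at this
    linarith
  rw [hinf, ← EReal.coe_mul]
  refine le_antisymm ?_ (le_iInf₂ fun u hu =>
    le_extIntegral_of_minimizer hl.le hy hyr hγ hγnonneg (hint u hu.1).1 (hint u hu.1).2 hu.2)
  -- the level `r` itself leaves no room for truncation, so approach it by levels `s < r`, whose
  -- multipliers stay below `l₀` by monotonicity
  obtain ⟨s₀, hs₀, hs₀r⟩ := EReal.lt_iff_exists_real_btwn.1 hαr
  obtain ⟨l₀, hl₀, y₀, hy₀, hys₀⟩ := hlevel hs₀ (hs₀r.trans hrβ)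
  have hs₀r' : s₀ < r := EReal.coe_lt_coe_iff.1 hs₀r
  have hbound : ∀ s ∈ Set.Ioo s₀ r,
      ⨅ u ∈ constraintSet μ p ψ γ r, extIntegral μ (fun t => γ t * φ (u t)) ≤
        (((φ y + l₀ * (r - s)) * ∫ t, γ t ∂μ : ℝ) : EReal) := by
    intro s hs
    obtain ⟨m, -, z, hz, hzs⟩ := hlevel (hs₀.trans (EReal.coe_lt_coe_iff.2 hs.1))
      ((EReal.coe_lt_coe_iff.2 hs.2).trans hrβ)
    have hm : m ≤ l₀ := by
      by_contra! hlt
      have := minimizer_constraint_anti hlt hy₀ hz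
      linarith [hs.1]
    refine (iInf_constraintSet_le μ hγ hγpos (hzs.trans_lt hs.2)).trans
      (EReal.coe_le_coe_iff.2 (mul_le_mul_of_nonneg_right ?_ hγpos.le))
    have h1 := hz y
    rw [hzs, hyr] at h1
    have h2 := mul_le_mul_of_nonneg_right hm (sub_nonneg.2 hs.2.le)
    linarith
  have hlim : Tendsto (fun s : ℝ => (φ y + l₀ * (r - s)) * ∫ t, γ t ∂μ) (𝓝[<] r)
      (𝓝 (φ y * ∫ t, γ t ∂μ)) := by
    have hc : Continuous fun s : ℝ => (φ y + l₀ * (r - s)) * ∫ t, γ t ∂μ := by fun_prop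
    simpa using (hc.tendsto r).mono_left nhdsWithin_le_nhds
  exact ge_of_tendsto ((continuous_coe_real_ereal.tendsto _).comp hlim)
    (eventually_of_mem (Ioo_mem_nhdsLT hs₀r') hbound)
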